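/- Let $r\ge 3$ and $n\ge k\ge r+3$ be integers. An $r$-graph $\mathcal H$ is a finite vertex set together with a set of distinct $r$-element subsets of it, called edges. A Berge path of length $k$ in $\mathcal H$ consists of $k+1$ distinct vertices $v_1,\dots,v_{k+1}$ and $k$ distinct edges $e_1,\dots,e_k$ such that $\{v_i,v_{i+1}\}\subseteq e_i$ for all $1\le i\le k$. If $\mathcal H$ is an $r$-graph on $n$ vertices that contains no Berge path of length $k$, then its number of edges satisfies $$e(\mathcal H)\le \frac{n}{k}\binom{k}{r},$$ with equality only if every connected component of $\mathcal H$ is a complete $r$-graph $K_k^{(r)}$, that is, has exactly $k$ vertices and has all $r$-element subsets of its vertex set as edges. -/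

import Mathlib

namespace Hypergraph

/-- `H` is `r`-uniform: every edge has exactly `r` elements. -/
def IsUniform {α : Type*} (H : Hypergraph α) (r : ℕ) : Prop :=
  ∀ e ∈ H.edgeSet, e.encard = r

/-- `H` contains a Berge path of length `l`: distinct vertices `v 0, …, v l` and distinct edges
`e 0, …, e (l - 1)` with `{v i, v (i + 1)} ⊆ e i` for all `i < l`. -/
def HasBergePath {α : Type*} (H : Hypergraph α) (l : ℕ) : Prop :=
  ∃ (v : Fin (l + 1) → α) (e : Fin l → Set α),
    Function.Injective v ∧ Function.Injective e ∧
    (∀ i, v i ∈ H.vertexSet) ∧ (∀ i, e i ∈ H.edgeSet) ∧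
    ∀ i : Fin l, {v i.castSucc, v i.succ} ⊆ e i

/-- The vertices of `H` that can be reached from the vertex `x` through consecutively
adjacent vertices, together with all edges of `H` inside this set. -/
def component {α : Type*} (H : Hypergraph α) (x : α) : Hypergraph α where
  vertexSet := {y | y ∈ H.vertexSet ∧ Relation.ReflTransGen H.Adj x y}
  edgeSet := {e | e ∈ H.edgeSet ∧ e ⊆ {y | y ∈ H.vertexSet ∧ Relation.ReflTransGen H.Adj x y}}
  subset_vertexSet_of_mem_edgeSet' := fun _ he => he.2

/-- `C` is a connected component of `H`. -/
def IsComponent {α : Type*} (H C : Hypergraph α) : Prop :=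
  ∃ x ∈ H.vertexSet, C = H.component x

/-- `H` is a complete `r`-graph on `k` vertices: it has exactly `k` vertices and its edges are all
the `r`-element subsets of its vertex set. -/
def IsCompleteUniform {α : Type*} (H : Hypergraph α) (k r : ℕ) : Prop :=
  H.vertexSet.encard = k ∧ H.edgeSet = {e | e ⊆ H.vertexSet ∧ e.encard = r}

end Hypergraph

/-!
# Berge paths in uniform hypergraphs

The bound is reduced to an extremal problem for graphs. Among all subfamilies `E'` of the edge set
`E`, choose one maximizing `#E' - #(pairs E')`, where `pairs E'` is the set of two-element sets
covered by `E'`. Colour the pairs in `pairs E'` blue. Hall's theorem matches `E \ E'` injectively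
with pairs outside `pairs E'`, which are coloured red, and it also matches all the blue pairs
injectively with edges in `E'` (`exists_matchings`). So every pair of the red-blue graph has its own
edge of `E` containing it, and a path in the graph gives a Berge path of the same length. Moreover
the members of `E'` are blue `r`-cliques and those of `E \ E'` are counted by red edges, whence
`#E` is at most the number of red edges plus the number of blue `r`-cliques (`exists_red_blue`).

It remains to bound this number by `n / k * k.choose r` for a red-blue graph on `n` vertices without
a path on `k + 1` vertices (`graph_bound`). A vertex of degree at most `(k - 1) / 2` lies in fewer
than `k.choose r / k` red edges and blue `r`-cliques (`loss_lt`) and is removed by induction. If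
there is no such vertex, then, as in Dirac's theorem, the vertices of a longest path of a component
form a cycle, which must be the whole component (`exists_closed`). So components have at most `k`
vertices and degrees are at most `k - 1`. Distributing each red edge and each blue clique evenly
among its vertices, no vertex receives more than `k.choose r / k`, and it receives exactly that much
only if it has no red edge and `k - 1` blue ones (`share_le`). Equality thus forces the graph to be
a disjoint union of blue copies of the complete graph on `k` vertices, and the hypergraph to consist
of all its `r`-cliques.
-/

namespace BergePath

open Finset
open scoped Classical

/-! ### Inequalities between binomial coefficients -/

theorem le_choose {n j : ℕ} (hj : 1 ≤ j) (hn : j + 1 ≤ n) : n ≤ n.choose j := by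
  induction n, hn using Nat.le_induction with
  | base => rw [Nat.choose_succ_self_right]
  | succ n hn ih =>
    obtain ⟨j, rfl⟩ := Nat.exists_eq_add_of_le' hj
    rw [Nat.choose_succ_succ']
    have : 0 < n.choose j := Nat.choose_pos (by omega)
    omega

theorem choose_two_lt_choose {k r : ℕ} (hr : 3 ≤ r) (hk : r + 3 ≤ k) :
    k.choose 2 < k.choose r := by
  induction k, hk using Nat.le_induction with
  | base =>
    rw [show (r + 3).choose r = (r + 3).choose 3 from Nat.choose_symm_add]
    have h := Nat.choose_succ_right_eq (r + 3) 2
    have hpos : 0 < (r + 3).choose 2 := Nat.choose_pos (by omega)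
    have h4 : 4 ≤ r + 3 - 2 := by omega
    norm_num at h
    nlinarith [Nat.mul_le_mul_left ((r + 3).choose 2) h4]
  | succ k hk ih =>
    obtain ⟨j, rfl⟩ := Nat.exists_eq_add_of_le' (show 1 ≤ r by omega)
    rw [Nat.choose_succ_succ' k 1, Nat.choose_succ_succ' k j, Nat.choose_one_right]
    have h2 : k.choose (1 + 1) = k.choose 2 := rfl
    have : k ≤ k.choose j := le_choose (by omega) (by omega)
    omega

/-- Compare the descending factorials factor by factor, using `2 * (m - i) ≤ n - i`. -/
theorem two_pow_mul_choose_le {m n : ℕ} (h : 2 * m ≤ n) (t : ℕ) :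
    2 ^ t * m.choose t ≤ n.choose t := by
  have hd : 2 ^ t * m.descFactorial t ≤ n.descFactorial t := by
    induction t with
    | zero => simp
    | succ t ih =>
      rw [Nat.descFactorial_succ, Nat.descFactorial_succ]
      calc 2 ^ (t + 1) * ((m - t) * m.descFactorial t)
          = (2 * (m - t)) * (2 ^ t * m.descFactorial t) := by ring
        _ ≤ (n - t) * n.descFactorial t := Nat.mul_le_mul (by omega) ih
  rw [Nat.descFactorial_eq_factorial_mul_choose, Nat.descFactorial_eq_factorial_mul_choose] at hd
  have := Nat.factorial_pos t
  refine le_of_mul_le_mul_left ?_ this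
  linarith

/-- `b.choose s / b` is nondecreasing in `b`. -/
theorem mul_choose_le_mul_choose {b D s : ℕ} (hs : 1 ≤ s) (hb : b ≤ D) :
    D * b.choose s ≤ b * D.choose s := by
  obtain ⟨t, rfl⟩ := Nat.exists_eq_add_of_le' hs
  rcases b with _ | b
  · simp
  obtain ⟨D, rfl⟩ := Nat.exists_eq_add_of_le' (show 1 ≤ D by omega)
  have h1 := Nat.add_one_mul_choose_eq b t
  have h2 := Nat.add_one_mul_choose_eq D t
  have h3 : b.choose t ≤ D.choose t := Nat.choose_le_choose t (by omega)
  refine le_of_mul_le_mul_right ?_ t.succ_pos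
  rw [mul_assoc, mul_assoc, ← h1, ← h2]
  calc _ = (D + 1) * (b + 1) * b.choose t := by ring
    _ ≤ (D + 1) * (b + 1) * D.choose t := Nat.mul_le_mul_left _ h3
    _ = _ := by ring

/-- For `b ≤ D / 2` the estimate `b.choose s / b ≤ D.choose s / D` improves by a factor
`2 ^ (s - 1)`, which exceeds `(s + 1) / 2`. -/
theorem mul_choose_lt_of_two_mul_le {b D s : ℕ} (hs : 2 ≤ s) (hsD : s ≤ D) (hb0 : 0 < b)
    (hb : 2 * b ≤ D) : D * ((s + 1) * b.choose s) < 2 * b * D.choose s := by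
  obtain ⟨t, rfl⟩ := Nat.exists_eq_add_of_le' (show 1 ≤ s by omega)
  obtain ⟨b, rfl⟩ := Nat.exists_eq_add_of_le' (show 1 ≤ b by omega)
  obtain ⟨D, rfl⟩ := Nat.exists_eq_add_of_le' (show 1 ≤ D by omega)
  have h1 := Nat.add_one_mul_choose_eq b t
  have h2 := Nat.add_one_mul_choose_eq D t
  have h3 : 2 ^ t * b.choose t ≤ D.choose t := two_pow_mul_choose_le (by omega) t
  have h4 : t + 1 + 1 < 2 * 2 ^ t := by
    obtain ⟨u, rfl⟩ := Nat.exists_eq_add_of_le' (show 1 ≤ t by omega)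
    have := Nat.lt_two_pow_self (n := u)
    rw [pow_succ]
    omega
  have h5 : 0 < D.choose t := Nat.choose_pos (by omega)
  have h6 : (t + 1 + 1) * b.choose t < 2 * D.choose t := by
    rcases Nat.eq_zero_or_pos (b.choose t) with h | h
    · rw [h]; omega
    · calc (t + 1 + 1) * b.choose t < 2 * 2 ^ t * b.choose t := by gcongr
        _ ≤ _ := by rw [mul_assoc]; gcongr
  refine lt_of_mul_lt_mul_right ?_ (Nat.zero_le (t + 1))
  calc (D + 1) * ((t + 1 + 1) * (b + 1).choose (t + 1)) * (t + 1)
      = (D + 1) * ((t + 1 + 1) * ((b + 1).choose (t + 1) * (t + 1))) := by ring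
    _ = (D + 1) * (b + 1) * ((t + 1 + 1) * b.choose t) := by rw [← h1]; ring
    _ < (D + 1) * (b + 1) * (2 * D.choose t) := by gcongr
    _ = 2 * (b + 1) * ((D + 1) * D.choose t) := by ring
    _ = _ := by rw [h2]; ring

/-- This is `k.choose 2 < k.choose r` divided by `k / 2`; it makes a red edge cost less than the
share of the bound that a complete blue graph spends on an edge. -/
theorem sub_one_lt_two_mul_choose_div {k r : ℕ} (hr : 3 ≤ r) (hk : r + 3 ≤ k) :
    ((k - 1 : ℕ) : ℝ) < 2 * ((k.choose r : ℝ) / k) := by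
  have h := choose_two_lt_choose hr hk
  have h2 : (k.choose 2 : ℝ) * 2 = k * ((k - 1 : ℕ) : ℝ) := by
    have := Nat.add_one_mul_choose_eq (k - 1) 1
    rw [show k - 1 + 1 = k by omega] at this
    simp at this
    exact_mod_cast this.symm
  have hk0 : (0 : ℝ) < k := by exact_mod_cast (by omega : 0 < k)
  rw [← mul_div_assoc, lt_div_iff₀ hk0]
  have : (k.choose 2 : ℝ) < k.choose r := by exact_mod_cast h
  linarith

theorem choose_div_eq {k r : ℕ} (hr : 1 ≤ r) (hk : 1 ≤ k) :
    (k.choose r : ℝ) / k = ((k - 1).choose (r - 1) : ℝ) / r := by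
  have h := Nat.add_one_mul_choose_eq (k - 1) (r - 1)
  rw [show k - 1 + 1 = k by omega, show r - 1 + 1 = r by omega] at h
  have hk0 : (k : ℝ) ≠ 0 := by exact_mod_cast (by omega : k ≠ 0)
  have hr0 : (r : ℝ) ≠ 0 := by exact_mod_cast (by omega : r ≠ 0)
  rw [div_eq_div_iff hk0 hr0, mul_comm _ (k : ℝ)]
  exact_mod_cast h.symm

/-- The share of a vertex with `a` red and `b` blue edges, when each red edge is split among its two
vertices and each blue `r`-clique among its `r` vertices. -/
theorem share_le {k r a b : ℕ} (hr : 3 ≤ r) (hk : r + 3 ≤ k) (hab : a + b ≤ k - 1) :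
    (a : ℝ) / 2 + (b.choose (r - 1) : ℝ) / r ≤ (k.choose r : ℝ) / k ∧
    ((a : ℝ) / 2 + (b.choose (r - 1) : ℝ) / r = (k.choose r : ℝ) / k → a = 0 ∧ b = k - 1) := by
  set c : ℝ := (k.choose r : ℝ) / k with hc
  have hD := sub_one_lt_two_mul_choose_div hr hk
  have hc' : c = ((k - 1).choose (r - 1) : ℝ) / r := choose_div_eq (by omega) (by omega)
  rw [← hc] at hD
  have hr0 : (0 : ℝ) < r := by exact_mod_cast (by omega : 0 < r)
  have hD0 : (0 : ℝ) < (k - 1 : ℕ) := by exact_mod_cast (by omega : 0 < k - 1)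
  have hb : ((k - 1 : ℕ) : ℝ) * ((b.choose (r - 1) : ℝ) / r) ≤ b * c := by
    rw [hc', ← mul_div_assoc, ← mul_div_assoc]
    have := mul_choose_le_mul_choose (s := r - 1) (by omega) (show b ≤ k - 1 by omega)
    refine div_le_div_of_nonneg_right ?_ hr0.le
    exact_mod_cast this
  have hab' : (a : ℝ) + b ≤ (k - 1 : ℕ) := by exact_mod_cast hab
  set D : ℝ := ((k - 1 : ℕ) : ℝ) with hDdef
  have ha0 : (0 : ℝ) ≤ a := by positivity
  have hc0 : 0 < c := by linarith
  have e1 : D * ((a : ℝ) / 2) ≤ a * c := by nlinarith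
  constructor
  · refine le_of_mul_le_mul_left ?_ hD0
    nlinarith
  · intro h
    have hm : D * ((a : ℝ) / 2) + D * ((b.choose (r - 1) : ℝ) / r) = D * c := by rw [← h]; ring
    have e2 : ((a : ℝ) + b) * c ≤ D * c := by gcongr
    have e3 : ((a : ℝ) + b) * c = D * c := by linarith
    have e4 : (a : ℝ) + b = D := mul_right_cancel₀ hc0.ne' e3
    have e5 : (a : ℝ) * (c - D / 2) = 0 := by nlinarith
    have e6 : (a : ℝ) = 0 := by
      rcases mul_eq_zero.1 e5 with h | h
      · exact h
      · linarith
    have e7 : a = 0 := by exact_mod_cast e6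
    refine ⟨e7, ?_⟩
    rw [hDdef] at e4
    have : a + b = k - 1 := by exact_mod_cast e4
    omega

/-- Deleting a vertex with `a` red and `b` blue edges destroys `a` red edges and at most
`b.choose (r - 1)` blue `r`-cliques; if the degree is small, this is below the average. -/
theorem loss_lt {k r a b : ℕ} (hr : 3 ≤ r) (hk : r + 3 ≤ k) (hab : 2 * (a + b) ≤ k - 1) :
    (a : ℝ) + (b.choose (r - 1) : ℝ) < (k.choose r : ℝ) / k := by
  set c : ℝ := (k.choose r : ℝ) / k with hc
  have hD := sub_one_lt_two_mul_choose_div hr hk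
  have hc' : c = ((k - 1).choose (r - 1) : ℝ) / r := choose_div_eq (by omega) (by omega)
  rw [← hc] at hD
  have hr0 : (0 : ℝ) < r := by exact_mod_cast (by omega : 0 < r)
  have hD0 : (0 : ℝ) < (k - 1 : ℕ) := by exact_mod_cast (by omega : 0 < k - 1)
  have hab' : 2 * ((a : ℝ) + b) ≤ (k - 1 : ℕ) := by exact_mod_cast hab
  rcases Nat.eq_zero_or_pos b with rfl | hb0
  · rw [Nat.choose_eq_zero_of_lt (by omega)]
    push_cast at hab' ⊢
    linarith
  have hb : ((k - 1 : ℕ) : ℝ) * (b.choose (r - 1) : ℝ) < 2 * b * c := by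
    rw [hc', ← mul_div_assoc, lt_div_iff₀ hr0]
    have := mul_choose_lt_of_two_mul_le (s := r - 1) (D := k - 1) (by omega) (by omega) hb0
      (by omega)
    rw [show r - 1 + 1 = r by omega] at this
    have h : ((k - 1 : ℕ) : ℝ) * (r * b.choose (r - 1)) < 2 * b * (k - 1).choose (r - 1) := by
      exact_mod_cast this
    linarith
  refine lt_of_mul_lt_mul_left ?_ hD0.le
  have ha0 : (0 : ℝ) ≤ a := by positivity
  have hc0 : 0 < c := by linarith
  nlinarith

/-! ### Counting cliques -/

variable {α : Type*}

/-- The `m`-element subsets of `V` that are cliques of `G`; for `m = 2` these are the edges of `G`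
inside `V`. -/
noncomputable def cliquesIn (G : SimpleGraph α) (m : ℕ) (V : Finset α) : Finset (Finset α) :=
  {e ∈ V.powersetCard m | G.IsClique (e : Set α)}

/-- The neighbours of `v` inside `V`. -/
noncomputable def nbrs (G : SimpleGraph α) (V : Finset α) (v : α) : Finset α :=
  {u ∈ V | G.Adj v u}

theorem mem_cliquesIn {G : SimpleGraph α} {m : ℕ} {V e : Finset α} :
    e ∈ cliquesIn G m V ↔ (e ⊆ V ∧ #e = m) ∧ G.IsClique (e : Set α) := by
  simp [cliquesIn, mem_powersetCard]

theorem mem_nbrs {G : SimpleGraph α} {V : Finset α} {v u : α} :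
    u ∈ nbrs G V v ↔ u ∈ V ∧ G.Adj v u := by
  simp [nbrs]

/-- Removing `v` from a clique containing `v` leaves a set of neighbours of `v`. -/
theorem card_cliquesIn_mem_le (G : SimpleGraph α) (m : ℕ) (V : Finset α) (v : α) :
    #{e ∈ cliquesIn G (m + 1) V | v ∈ e} ≤ (#(nbrs G V v)).choose m := by
  rw [← card_powersetCard]
  refine card_le_card_of_injOn (fun e => e.erase v) ?_ ?_
  · intro e he
    simp only [coe_filter, Set.mem_ofPred_eq, mem_cliquesIn] at he
    obtain ⟨⟨⟨heV, hc⟩, hq⟩, hv⟩ := he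
    rw [mem_coe, mem_powersetCard]
    refine ⟨fun u hu => ?_, by rw [card_erase_of_mem hv, hc]; rfl⟩
    rw [mem_erase] at hu
    exact mem_nbrs.2 ⟨heV hu.2, hq hv hu.2 hu.1.symm⟩
  · intro e he f hf hef
    simp only [coe_filter, Set.mem_ofPred_eq] at he hf
    rw [← insert_erase he.2, ← insert_erase hf.2]
    exact congrArg (insert v) hef

theorem card_cliquesIn_le_erase_add (G : SimpleGraph α) (m : ℕ) (V : Finset α) (v : α) :
    #(cliquesIn G (m + 1) V) ≤
      #(cliquesIn G (m + 1) (V.erase v)) + (#(nbrs G V v)).choose m := by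
  rw [← card_filter_add_card_filter_not (s := cliquesIn G (m + 1) V) (fun e => v ∈ e), add_comm]
  refine add_le_add (card_le_card fun e he => ?_) (card_cliquesIn_mem_le G m V v)
  simp only [mem_filter, mem_cliquesIn] at he ⊢
  exact ⟨⟨subset_erase.2 ⟨he.1.1.1, he.2⟩, he.1.1.2⟩, he.1.2⟩

theorem mul_card_cliquesIn_le (G : SimpleGraph α) (m : ℕ) (V : Finset α) :
    (m + 1) * #(cliquesIn G (m + 1) V) ≤ ∑ v ∈ V, (#(nbrs G V v)).choose m := by
  have h := sum_card_bipartiteAbove_eq_sum_card_bipartiteBelow (s := V)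
    (t := cliquesIn G (m + 1) V) (fun v e => v ∈ e)
  have h2 : ∑ e ∈ cliquesIn G (m + 1) V, #(V.bipartiteBelow (fun v e => v ∈ e) e)
      = (m + 1) * #(cliquesIn G (m + 1) V) := by
    rw [mul_comm, ← smul_eq_mul, ← sum_const]
    refine sum_congr rfl fun e he => ?_
    rw [mem_cliquesIn] at he
    rw [← he.1.2, bipartiteBelow, filter_mem_eq_inter, inter_eq_right.2 he.1.1]
  rw [← h2, ← h]
  exact sum_le_sum fun v _ => card_cliquesIn_mem_le G m V v

/-! ### Longest paths in graphs of large minimum degree -/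

/-- The list `l` is the vertex sequence of a path of `G` inside `V`; it has `l.length - 1` edges. -/
def IsPathIn (G : SimpleGraph α) (V : Finset α) (l : List α) : Prop :=
  l.Nodup ∧ (∀ x ∈ l, x ∈ V) ∧ l.IsChain G.Adj

theorem exists_longest {G : SimpleGraph α} {V : Finset α} (P : List α → Prop) {l₀ : List α}
    (h₀ : IsPathIn G V l₀) (hP : P l₀) :
    ∃ l, (IsPathIn G V l ∧ P l) ∧ ∀ l', IsPathIn G V l' → P l' → l'.length ≤ l.length := by
  have hb : ∀ l, IsPathIn G V l → l.length ≤ #V := fun l hl => by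
    rw [← List.toFinset_card_of_nodup hl.1]
    exact card_le_card fun x hx => hl.2.1 x (List.mem_toFinset.1 hx)
  obtain ⟨l, hl, hmin⟩ := WellFounded.has_min (measure fun l : List α => #V - l.length).wf
    {l | IsPathIn G V l ∧ P l} ⟨l₀, h₀, hP⟩
  refine ⟨l, hl, fun l' h1 h2 => ?_⟩
  have h3 := hb l' h1
  have h4 := hb l hl.1
  have : ¬ (#V - l'.length < #V - l.length) := hmin l' ⟨h1, h2⟩
  omega

/-- If the ends of a path are adjacent, the path closes up to a cycle, and any neighbour `w` of the
cycle can be put in front of it after cutting the cycle open at a vertex `u` adjacent to `w`. -/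
theorem IsPathIn.extend_cycle {G : SimpleGraph α} {V : Finset α} {l : List α}
    (hl : IsPathIn G V l) (hclose : ∀ x ∈ l.getLast?, ∀ y ∈ l.head?, G.Adj x y)
    {u w : α} (hu : u ∈ l) (hw : w ∉ l) (hwV : w ∈ V) (huw : G.Adj u w) :
    ∃ l', IsPathIn G V l' ∧ l'.length = l.length + 1 ∧ ∀ x ∈ l, x ∈ l' := by
  obtain ⟨X, Y, rfl⟩ := List.append_of_mem hu
  obtain ⟨hn, hV, hc⟩ := hl
  refine ⟨w :: u :: (Y ++ X), ⟨?_, ?_, ?_⟩, ?_, ?_⟩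
  · have hp : (u :: (Y ++ X)).Perm (X ++ u :: Y) := by
      rw [← List.cons_append]; exact List.perm_append_comm
    rw [List.nodup_cons, hp.mem_iff, hp.nodup_iff]
    exact ⟨hw, hn⟩
  · intro x hx
    simp only [List.mem_cons, List.mem_append] at hx hV
    grind
  · rw [List.isChain_cons_cons]
    refine ⟨huw.symm, ?_⟩
    rw [← List.cons_append, List.isChain_append]
    rw [List.isChain_append] at hc
    refine ⟨hc.2.1, hc.1, fun x hx y hy => hclose x ?_ y ?_⟩
    · rw [List.getLast?_append]; simp_all
    · cases X <;> simp_all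
  · simp; omega
  · intro x hx
    simp only [List.mem_cons, List.mem_append] at hx ⊢
    tauto

theorem IsPathIn.reverse {G : SimpleGraph α} {V : Finset α} {l : List α}
    (hl : IsPathIn G V l) : IsPathIn G V l.reverse := by
  refine ⟨List.nodup_reverse.2 hl.1, fun x hx => hl.2.1 x (List.mem_reverse.1 hx), ?_⟩
  rw [List.isChain_reverse]
  exact hl.2.2.imp fun _ _ h => h.symm

theorem IsPathIn.cons {G : SimpleGraph α} {V : Finset α} {a w : α} {t : List α}
    (hl : IsPathIn G V (a :: t)) (hw : w ∉ a :: t) (hwV : w ∈ V) (h : G.Adj a w) :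
    IsPathIn G V (w :: a :: t) := by
  refine ⟨List.nodup_cons.2 ⟨hw, hl.1⟩, fun x hx => ?_, List.isChain_cons_cons.2 ⟨h.symm, hl.2.2⟩⟩
  rcases List.mem_cons.1 hx with rfl | hx
  · exact hwV
  · exact hl.2.1 x hx

/-- Pósa rotation: if the last vertex of `A` is adjacent to the last vertex of `B`, the part `B` of
the path can be traversed backwards. -/
theorem IsPathIn.rotate_split {G : SimpleGraph α} {V : Finset α} {A B : List α}
    (hl : IsPathIn G V (A ++ B)) (h : ∀ x ∈ A.getLast?, ∀ z ∈ B.getLast?, G.Adj x z) :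
    IsPathIn G V (A ++ B.reverse) := by
  obtain ⟨hn, hV, hc⟩ := hl
  rw [List.isChain_append] at hc
  refine ⟨?_, ?_, ?_⟩
  · rw [((List.reverse_perm B).append_left A).nodup_iff]
    exact hn
  · simpa using hV
  · rw [List.isChain_append, List.isChain_reverse]
    refine ⟨hc.1, hc.2.1.imp fun _ _ h => h.symm, fun x hx y hy => h x hx y ?_⟩
    rwa [List.head?_reverse] at hy

/-- If all neighbours of both ends of a path lie on the path and their number is at least the number
of vertices of the path, then these vertices can be reordered to a path whose ends are adjacent. -/
theorem IsPathIn.exists_cycle {G : SimpleGraph α} {V : Finset α} {l : List α} {a z : α}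
    (hl : IsPathIn G V l) (ha : a ∈ l.head?) (hz : z ∈ l.getLast?)
    (hNa : ∀ y, y ∈ nbrs G V a → y ∈ l) (hNz : ∀ y, y ∈ nbrs G V z → y ∈ l)
    (hdeg : l.length ≤ #(nbrs G V a) + #(nbrs G V z)) :
    ∃ l', IsPathIn G V l' ∧ l'.Perm l ∧ ∀ x ∈ l'.getLast?, ∀ y ∈ l'.head?, G.Adj x y := by
  have hpos : 0 < l.length := by
    rcases l with _ | _ <;> simp_all
  have ha' : l[0] = a := by
    rw [List.head?_eq_getElem?] at ha
    simpa using (List.getElem?_eq_some_iff.1 ha).2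
  have hz' : l[l.length - 1] = z := by
    rw [List.getLast?_eq_getElem?] at hz
    simpa using (List.getElem?_eq_some_iff.1 hz).2
  let f : ℕ → α := fun i => l.getD i a
  have hf : ∀ i (hi : i < l.length), f i = l[i] := fun i hi => List.getD_eq_getElem l a hi
  -- By pigeonhole there is `i` with `a` adjacent to `l[i + 1]` and `z` adjacent to `l[i]`.
  let I := (range (l.length - 1)).filter fun i => G.Adj a (f (i + 1))
  let J := (range (l.length - 1)).filter fun i => G.Adj z (f i)
  have hI : #(nbrs G V a) ≤ #I := by
    refine le_trans (card_le_card (t := I.image fun i => f (i + 1)) fun y hy => ?_) card_image_le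
    obtain ⟨i, hi, rfl⟩ := List.getElem_of_mem (hNa y hy)
    have hadj := (mem_nbrs.1 hy).2
    rcases i with _ | i
    · rw [ha'] at hadj; exact absurd hadj (G.irrefl)
    · rw [mem_image]
      refine ⟨i, mem_filter.2 ⟨mem_range.2 (by omega), ?_⟩, hf _ hi⟩
      rwa [hf _ hi]
  have hJ : #(nbrs G V z) ≤ #J := by
    refine le_trans (card_le_card (t := J.image f) fun y hy => ?_) card_image_le
    obtain ⟨i, hi, rfl⟩ := List.getElem_of_mem (hNz y hy)
    have hadj := (mem_nbrs.1 hy).2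
    have hne : i ≠ l.length - 1 := by
      rintro rfl
      rw [hz'] at hadj; exact G.irrefl hadj
    rw [mem_image]
    refine ⟨i, mem_filter.2 ⟨mem_range.2 (by omega), ?_⟩, hf _ hi⟩
    rwa [hf _ hi]
  have hIJ : ∃ i, i ∈ I ∩ J := by
    by_contra hcon
    push Not at hcon
    have h0 : #(I ∩ J) = 0 := by
      rw [card_eq_zero]; exact eq_empty_of_forall_notMem hcon
    have h1 := card_union_add_card_inter I J
    have h2 : #(I ∪ J) ≤ l.length - 1 := by
      rw [← card_range (l.length - 1)]
      exact card_le_card (union_subset (filter_subset _ _) (filter_subset _ _))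
    omega
  obtain ⟨i, hi⟩ := hIJ
  obtain ⟨⟨hi1, hi2⟩, -, hi3⟩ := And.imp mem_filter.1 mem_filter.1 (mem_inter.1 hi)
  rw [mem_range] at hi1
  rw [hf _ (by omega)] at hi2 hi3
  refine ⟨l.take (i + 1) ++ (l.drop (i + 1)).reverse, ?_, ?_, ?_⟩
  · refine IsPathIn.rotate_split (by rwa [List.take_append_drop]) fun x hx w hw => ?_
    rw [List.getLast?_take] at hx
    rw [List.getLast?_drop] at hw
    have hx' : l[i] = x := by simp [show i < l.length by omega] at hx; exact hx
    have hw' : w = z := by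
      rw [if_neg (by omega)] at hw
      exact Option.mem_unique hw hz
    rw [← hx', hw']
    exact hi3.symm
  · conv_rhs => rw [← List.take_append_drop (i + 1) l]
    exact (List.reverse_perm _).append_left _
  · intro x hx y hy
    have hx' : l[i + 1] = x := by
      rw [List.getLast?_append, List.getLast?_reverse, List.head?_drop] at hx
      simpa [show i + 1 < l.length by omega] using hx
    have hy' : y = a := by
      rw [List.head?_append, List.head?_take, if_neg (by omega)] at hy
      rw [Option.mem_def.1 ha] at hy
      simpa [eq_comm] using hy
    rw [← hx', hy']
    exact hi2.symm

/-- In a graph without a path on `k + 1` vertices in which all degrees are at least `k / 2`, every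
vertex lies in a set of at most `k` vertices which no edge leaves. -/
theorem exists_closed {G : SimpleGraph α} {V : Finset α} {k : ℕ}
    (hpath : ∀ l, IsPathIn G V l → l.length ≤ k) (hdeg : ∀ v ∈ V, k ≤ 2 * #(nbrs G V v))
    {v : α} (hv : v ∈ V) :
    ∃ S ⊆ V, v ∈ S ∧ #S ≤ k ∧ ∀ x ∈ S, ∀ y ∈ V, G.Adj x y → y ∈ S := by
  -- Only paths meeting the component of `v` compete, so that the longest one fills this component.
  let P : List α → Prop := fun l =>
    ∃ x ∈ l, Relation.ReflTransGen (fun x y => G.Adj x y ∧ x ∈ V) v x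
  have hP : ∀ {l l'}, P l → (∀ x ∈ l, x ∈ l') → P l' := fun ⟨x, hx, hr⟩ h => ⟨x, h x hx, hr⟩
  obtain ⟨l, ⟨hl, hlP⟩, hmax⟩ := exists_longest (G := G) (V := V) P (l₀ := [v])
    ⟨by simp, by simpa using hv, by simp⟩ ⟨v, by simp, .refl⟩
  have hend : ∀ l', IsPathIn G V l' → l'.Perm l → ∀ a ∈ l'.head?, ∀ y ∈ nbrs G V a, y ∈ l := by
    intro l' hl' hp a ha y hy
    by_contra hyl
    obtain ⟨t, rfl⟩ := List.head?_eq_some_iff.1 ha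
    have h := hmax _ (hl'.cons (hp.mem_iff.not.2 hyl) (mem_nbrs.1 hy).1 (mem_nbrs.1 hy).2)
      (hP hlP fun x hx => List.mem_cons_of_mem _ (hp.mem_iff.2 hx))
    have := hp.length_eq
    simp only [List.length_cons] at h this
    omega
  have hne : l ≠ [] := by
    obtain ⟨x, hx, -⟩ := hlP
    exact List.ne_nil_of_mem hx
  have ha : l.head hne ∈ l.head? := List.head_mem_head? hne
  have hz : l.getLast hne ∈ l.getLast? := List.getLast_mem_getLast? hne
  obtain ⟨c, hc, hcl, hclose⟩ := hl.exists_cycle ha hz (hend l hl (List.Perm.refl _) _ ha)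
    (hend _ hl.reverse (List.reverse_perm l) _ (by rwa [List.head?_reverse])) (by
      have h1 := hdeg _ (hl.2.1 _ (List.head_mem hne))
      have h2 := hdeg _ (hl.2.1 _ (List.getLast_mem hne))
      have h3 := hpath l hl
      omega)
  have hclosed : ∀ x ∈ c.toFinset, ∀ y ∈ V, G.Adj x y → y ∈ c.toFinset := by
    intro x hx y hy hxy
    by_contra hyc
    rw [List.mem_toFinset] at hx hyc
    obtain ⟨l', hl', hlen, hsub⟩ := hc.extend_cycle hclose hx hyc hy hxy
    have := hmax l' hl' (hP hlP fun x hx => hsub x (hcl.mem_iff.2 hx))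
    have := hcl.length_eq
    omega
  refine ⟨c.toFinset, fun x hx => hc.2.1 x (List.mem_toFinset.1 hx), ?_, ?_, hclosed⟩
  · obtain ⟨x, hx, hr⟩ := hlP
    clear hmax hP hv P
    induction hr using Relation.ReflTransGen.head_induction_on with
    | refl => exact List.mem_toFinset.2 (hcl.mem_iff.2 hx)
    | head h _ ih => exact hclosed _ ih _ h.2 h.1.symm
  · rw [List.toFinset_card_of_nodup hc.1]
    exact hpath c hc

/-! ### The bound for red-blue graphs -/

/-- `R` and `B` are the red and the blue graph. In the case of equality the red graph has no edges
and `V` is a disjoint union of `k`-cliques of the blue graph without further blue edges. -/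
theorem graph_bound {R B : SimpleGraph α} (hRB : Disjoint R B) {k r : ℕ} (hr : 3 ≤ r)
    (hk : r + 3 ≤ k) (V : Finset α) (hpath : ∀ l, IsPathIn (R ⊔ B) V l → l.length ≤ k) :
    (#(cliquesIn R 2 V) : ℝ) + #(cliquesIn B r V) ≤ #V * ((k.choose r : ℝ) / k) ∧
    ((#(cliquesIn R 2 V) : ℝ) + #(cliquesIn B r V) = #V * ((k.choose r : ℝ) / k) →
      (∀ x ∈ V, ∀ y ∈ V, ¬ R.Adj x y) ∧
      ∀ v ∈ V, ∃ S ⊆ V, v ∈ S ∧ #S = k ∧ B.IsClique (S : Set α) ∧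
        ∀ x ∈ S, ∀ y ∈ V, B.Adj x y → y ∈ S) := by
  obtain ⟨s, rfl⟩ := Nat.exists_eq_add_of_le' (show 1 ≤ r by omega)
  have hsum : ∀ v, #(nbrs (R ⊔ B) V v) = #(nbrs R V v) + #(nbrs B V v) := by
    intro v
    rw [← card_union_of_disjoint]
    · congr 1
      ext u
      simp only [mem_union, mem_nbrs, SimpleGraph.sup_adj]
      tauto
    · rw [Finset.disjoint_left]
      intro u h1 h2
      exact (SimpleGraph.disjoint_left.1 hRB _ _ (mem_nbrs.1 h1).2) (mem_nbrs.1 h2).2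
  by_cases hlow : ∃ v ∈ V, 2 * #(nbrs (R ⊔ B) V v) ≤ k - 1
  · obtain ⟨v, hv, hd⟩ := hlow
    have ih := (graph_bound hRB hr hk (V.erase v) fun l hl =>
      hpath l ⟨hl.1, fun x hx => mem_of_mem_erase (hl.2.1 x hx), hl.2.2⟩).1
    rw [hsum] at hd
    have hloss := loss_lt hr hk hd
    have h1 : (#(cliquesIn R 2 V) : ℝ) ≤ #(cliquesIn R 2 (V.erase v)) + #(nbrs R V v) := by
      have := card_cliquesIn_le_erase_add R 1 V v
      rw [Nat.choose_one_right] at this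
      exact_mod_cast this
    have h2 : (#(cliquesIn B (s + 1) V) : ℝ) ≤
        #(cliquesIn B (s + 1) (V.erase v)) + (#(nbrs B V v)).choose s := by
      exact_mod_cast card_cliquesIn_le_erase_add B s V v
    have h3 : (#(V.erase v) : ℝ) + 1 = #V := by exact_mod_cast card_erase_add_one hv
    rw [Nat.add_sub_cancel] at hloss
    have hlt : (#(cliquesIn R 2 V) : ℝ) + #(cliquesIn B (s + 1) V) <
        #V * ((k.choose (s + 1) : ℝ) / k) := by
      rw [← h3]; linarith
    exact ⟨hlt.le, fun h => absurd h hlt.ne⟩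
  · -- All degrees are at least `k / 2`, so `exists_closed` applies at every vertex.
    push Not at hlow
    have hcl := fun v (hv : v ∈ V) =>
      exists_closed hpath (fun v hv => by have := hlow v hv; omega) hv
    have hsubS : ∀ S ⊆ V, ∀ v ∈ S, (∀ x ∈ S, ∀ y ∈ V, (R ⊔ B).Adj x y → y ∈ S) →
        nbrs (R ⊔ B) V v ⊆ S.erase v := fun S hS v hv h u hu => by
      rw [mem_nbrs] at hu
      exact mem_erase.2 ⟨hu.2.ne', h v hv u hu.1 hu.2⟩
    have hdeg : ∀ v ∈ V, #(nbrs R V v) + #(nbrs B V v) ≤ k - 1 := by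
      intro v hv
      obtain ⟨S, hSV, hvS, hSk, h⟩ := hcl v hv
      rw [← hsum]
      have := card_le_card (hsubS S hSV v hvS h)
      rw [card_erase_of_mem hvS] at this
      omega
    have hR : (#(cliquesIn R 2 V) : ℝ) ≤ ∑ v ∈ V, (#(nbrs R V v) : ℝ) / 2 := by
      rw [← sum_div, le_div_iff₀ (by norm_num), mul_comm]
      have := mul_card_cliquesIn_le R 1 V
      simp only [Nat.choose_one_right] at this
      exact_mod_cast this
    have hB : (#(cliquesIn B (s + 1) V) : ℝ) ≤
        ∑ v ∈ V, ((#(nbrs B V v)).choose s : ℝ) / (s + 1 : ℕ) := by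
      rw [← sum_div, le_div_iff₀ (by positivity), mul_comm]
      exact_mod_cast mul_card_cliquesIn_le B s V
    have hshare := fun v hv => share_le hr hk (hdeg v hv)
    simp only [Nat.add_sub_cancel] at hshare
    have hle := sum_le_sum fun v hv => (hshare v hv).1
    rw [sum_add_distrib, sum_const, nsmul_eq_mul] at hle
    refine ⟨by linarith, fun heq => ?_⟩
    have hall := (sum_eq_sum_iff_of_le fun v hv => (hshare v hv).1).1 (by
      rw [sum_add_distrib, sum_const, nsmul_eq_mul]; linarith)
    have hdegs := fun v hv => (hshare v hv).2 (hall v hv)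
    have hnoR : ∀ x ∈ V, ∀ y ∈ V, ¬ R.Adj x y := by
      intro x hx y hy hxy
      have := card_eq_zero.1 (hdegs x hx).1
      have hmem : y ∈ nbrs R V x := mem_nbrs.2 ⟨hy, hxy⟩
      rw [this] at hmem
      exact notMem_empty _ hmem
    refine ⟨hnoR, fun v hv => ?_⟩
    obtain ⟨S, hSV, hvS, hSk, h⟩ := hcl v hv
    -- Equality makes all degrees equal to `k - 1`, which leaves no room in `S`.
    have heqS : ∀ x ∈ S, nbrs (R ⊔ B) V x = S.erase x ∧ #S = k := by
      intro x hx
      have h1 := hdegs x (hSV hx)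
      have h2 := hsum x
      have h3 := hsubS S hSV x hx h
      have h4 := card_erase_add_one hx
      have h5 := card_le_card h3
      exact ⟨eq_of_subset_of_card_le h3 (by omega), by omega⟩
    refine ⟨S, hSV, hvS, (heqS v hvS).2, ?_, fun x hx y hy hxy => h x hx y hy (Or.inr hxy)⟩
    intro x hx y hy hxy
    have : y ∈ nbrs (R ⊔ B) V x := by
      rw [(heqS x hx).1]; exact mem_erase.2 ⟨hxy.symm, hy⟩
    exact (mem_nbrs.1 this).2.resolve_left (hnoR x (hSV hx) y (hSV hy))
termination_by #V
decreasing_by exact card_erase_lt_of_mem hv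

/-! ### The red-blue graph of a family of sets -/

/-- The two-element subsets of the members of `E`. -/
noncomputable def pairs (E : Finset (Finset α)) : Finset (Finset α) :=
  E.biUnion fun e => e.powersetCard 2

theorem mem_pairs {E : Finset (Finset α)} {p : Finset α} :
    p ∈ pairs E ↔ #p = 2 ∧ ∃ e ∈ E, p ⊆ e := by
  simp only [pairs, mem_biUnion, mem_powersetCard]
  grind

/-- A subfamily `E'` maximizing `#E' - #(pairs E')` satisfies Hall's condition in both directions:
adding members to `E'`, or removing them, cannot increase this difference. -/
theorem exists_matchings (E : Finset (Finset α)) :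
    ∃ E' ⊆ E,
      (∃ ψ : {e // e ∈ E \ E'} → Finset α, ψ.Injective ∧
        ∀ e, #(ψ e) = 2 ∧ ψ e ⊆ e ∧ ψ e ∉ pairs E') ∧
      ∃ φ : {p // p ∈ pairs E'} → Finset α, φ.Injective ∧ ∀ p, φ p ∈ E' ∧ p.1 ⊆ φ p := by
  obtain ⟨E', hE', hmax⟩ := exists_max_image E.powerset
    (fun S => (#S : ℤ) - #(pairs S)) ⟨∅, empty_mem_powerset E⟩
  rw [mem_powerset] at hE'
  refine ⟨E', hE', ?_, ?_⟩
  · obtain ⟨ψ, hψ, hmem⟩ := (all_card_le_biUnion_card_iff_exists_injective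
      fun e : {e // e ∈ E \ E'} => e.1.powersetCard 2 \ pairs E').1 fun s => by
        set T := s.map ⟨Subtype.val, Subtype.val_injective⟩ with hT
        have hTE : T ⊆ E \ E' := fun e he => by
          obtain ⟨x, -, rfl⟩ := mem_map.1 he
          exact x.2
        have h1 := hmax (E' ∪ T) (mem_powerset.2 (union_subset hE' (hTE.trans sdiff_subset)))
        have h2 : #(E' ∪ T) = #E' + #s := by
          rw [card_union_of_disjoint, hT, card_map]
          exact (disjoint_sdiff.mono_right hTE)
        have h3 : pairs (E' ∪ T) ⊆
            pairs E' ∪ s.biUnion fun e => e.1.powersetCard 2 \ pairs E' := by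
          intro p hp
          rw [mem_union, or_iff_not_imp_left]
          intro hp'
          obtain ⟨hp2, e, he, hpe⟩ := mem_pairs.1 hp
          rcases mem_union.1 he with he | he
          · exact absurd (mem_pairs.2 ⟨hp2, e, he, hpe⟩) hp'
          · obtain ⟨x, hx, rfl⟩ := mem_map.1 he
            exact mem_biUnion.2 ⟨x, hx, mem_sdiff.2 ⟨mem_powersetCard.2 ⟨hpe, hp2⟩, hp'⟩⟩
        have h4 := (card_le_card h3).trans (card_union_le _ _)
        omega
    refine ⟨ψ, hψ, fun e => ?_⟩
    have := hmem e
    rw [mem_sdiff, mem_powersetCard] at this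
    exact ⟨this.1.2, this.1.1, this.2⟩
  · obtain ⟨φ, hφ, hmem⟩ := (all_card_le_biUnion_card_iff_exists_injective
      fun p : {p // p ∈ pairs E'} => {e ∈ E' | p.1 ⊆ e}).1 fun s => by
        set P := s.map ⟨Subtype.val, Subtype.val_injective⟩ with hP
        have hPE : P ⊆ pairs E' := fun e he => by
          obtain ⟨x, -, rfl⟩ := mem_map.1 he
          exact x.2
        set Q := s.biUnion fun p => {e ∈ E' | p.1 ⊆ e} with hQ
        have hQE : Q ⊆ E' := biUnion_subset.2 fun _ _ => filter_subset _ _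
        have h1 := hmax (E' \ Q) (mem_powerset.2 (sdiff_subset.trans hE'))
        have h2 := card_sdiff_add_card_eq_card hQE
        have h3 : pairs (E' \ Q) ⊆ pairs E' \ P := by
          intro p hp
          obtain ⟨hp2, e, he, hpe⟩ := mem_pairs.1 hp
          rw [mem_sdiff] at he ⊢
          refine ⟨mem_pairs.2 ⟨hp2, e, he.1, hpe⟩, fun hpP => he.2 ?_⟩
          obtain ⟨x, hx, rfl⟩ := mem_map.1 hpP
          exact mem_biUnion.2 ⟨x, hx, mem_filter.2 ⟨he.1, hpe⟩⟩
        have h4 := card_le_card h3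
        have h5 := card_sdiff_add_card_eq_card hPE
        have h6 : #P = #s := card_map _
        omega
    refine ⟨φ, hφ, fun p => ?_⟩
    simpa using hmem p

/-- The graph whose edges are the two-element sets satisfying `p`. -/
def pairGraph (p : Finset α → Prop) : SimpleGraph α where
  Adj x y := x ≠ y ∧ p {x, y}
  symm := ⟨fun x y h => ⟨h.1.symm, by rw [pair_comm]; exact h.2⟩⟩
  loopless := ⟨fun x h => h.1 rfl⟩

/-- The red graph `R` and the blue graph `B` attached to `E`: their edges are represented by
distinct members `φ {x, y}` of `E`, and `#E` is at most the number of red edges plus the number of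
blue `r`-cliques. -/
theorem exists_red_blue (E : Finset (Finset α)) {V : Finset α} {r : ℕ}
    (hE : ∀ e ∈ E, e ⊆ V ∧ #e = r) :
    ∃ R B : SimpleGraph α, Disjoint R B ∧
      #E ≤ #(cliquesIn R 2 V) + #(cliquesIn B r V) ∧
      (∀ x y, B.Adj x y → ∃ e ∈ E, x ∈ e ∧ y ∈ e) ∧
      ((∀ x ∈ V, ∀ y ∈ V, ¬ R.Adj x y) → E ⊆ cliquesIn B r V) ∧
      ∃ φ : Finset α → Finset α,
        (∀ x y, (R ⊔ B).Adj x y → φ {x, y} ∈ E ∧ {x, y} ⊆ φ {x, y}) ∧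
        ∀ x y z w, (R ⊔ B).Adj x y → (R ⊔ B).Adj z w → φ {x, y} = φ {z, w} →
          ({x, y} : Finset α) = {z, w} := by
  obtain ⟨E', hE', ⟨ψ, hψ, hψm⟩, φ, hφ, hφm⟩ := exists_matchings E
  have hB : ∀ e ∈ E', e ∈ cliquesIn (pairGraph (· ∈ pairs E')) r V := fun e he => by
    refine mem_cliquesIn.2 ⟨hE e (hE' he), fun x hx y hy hxy => ⟨hxy, ?_⟩⟩
    refine mem_pairs.2 ⟨card_pair hxy, e, he, ?_⟩
    exact insert_subset hx (singleton_subset_iff.2 hy)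
  -- An edge outside `E'` is matched to a pair, which is a red edge inside `V`.
  have hR : ∀ e, ∃ x ∈ V, ∃ y ∈ V, x ≠ y ∧ ψ e = {x, y} := fun e => by
    obtain ⟨x, y, hxy, h⟩ := card_eq_two.1 (hψm e).1
    have hs := (hψm e).2.1.trans (hE e (mem_sdiff.1 e.2).1).1
    rw [h] at hs
    exact ⟨x, hs (by simp), y, hs (by simp), hxy, h⟩
  refine ⟨pairGraph (· ∈ Set.range ψ), pairGraph (· ∈ pairs E'), ?_, ?_, ?_, ?_, ?_⟩
  · rw [SimpleGraph.disjoint_left]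
    rintro x y ⟨-, e, he⟩ ⟨-, h⟩
    rw [← he] at h
    exact (hψm e).2.2 h
  · rw [← card_sdiff_add_card_eq_card hE']
    refine add_le_add ?_ (card_le_card hB)
    rw [← card_attach, ← card_image_of_injective _ hψ]
    refine card_le_card fun p hp => ?_
    obtain ⟨e, -, rfl⟩ := mem_image.1 hp
    obtain ⟨x, hx, y, hy, hxy, h⟩ := hR e
    refine mem_cliquesIn.2 ⟨⟨?_, (hψm e).1⟩, ?_⟩
    · exact (hψm e).2.1.trans (hE e (mem_sdiff.1 e.2).1).1
    · rw [h, coe_pair, SimpleGraph.isClique_pair]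
      exact fun _ => ⟨hxy, e, h⟩
  · rintro x y ⟨-, h⟩
    obtain ⟨-, e, he, hs⟩ := mem_pairs.1 h
    exact ⟨e, hE' he, hs (by simp), hs (by simp)⟩
  · intro hno e he
    by_contra hcon
    have heE : e ∈ E \ E' := mem_sdiff.2 ⟨he, fun h => hcon (hB e h)⟩
    obtain ⟨x, hx, y, hy, hxy, h⟩ := hR ⟨e, heE⟩
    exact hno x hx y hy ⟨hxy, _, h⟩
  · have hinv : ∀ p, (p ∈ Set.range ψ) → ∃ e ∈ E \ E', p ⊆ e ∧ ∃ h, ψ ⟨e, h⟩ = p := by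
      rintro _ ⟨e, rfl⟩
      exact ⟨e, e.2, (hψm e).2.1, e.2, rfl⟩
    choose! ρ hρ hρs hρψ using hinv
    refine ⟨fun p => if h : p ∈ pairs E' then φ ⟨p, h⟩ else ρ p, ?_, ?_⟩
    · rintro x y h
      by_cases hp : ({x, y} : Finset α) ∈ pairs E'
      · simp only [hp, dite_true]
        exact ⟨hE' (hφm _).1, (hφm ⟨_, hp⟩).2⟩
      · have hr := (h.resolve_right fun h => hp h.2).2
        simp only [hp, dite_false]
        exact ⟨(mem_sdiff.1 (hρ _ hr)).1, hρs _ hr⟩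
    · rintro x y z w h h' heq
      by_cases hp : ({x, y} : Finset α) ∈ pairs E' <;>
      by_cases hq : ({z, w} : Finset α) ∈ pairs E' <;>
      simp only [hp, hq, dite_true, dite_false] at heq
      · exact congrArg Subtype.val (hφ heq)
      · have hr := (h'.resolve_right fun h => hq h.2).2
        exact absurd (heq ▸ (hφm ⟨_, hp⟩).1) (mem_sdiff.1 (hρ _ hr)).2
      · have hr := (h.resolve_right fun h => hp h.2).2
        exact absurd (heq ▸ (hφm ⟨_, hq⟩).1) (mem_sdiff.1 (hρ _ hr)).2
      · have hr := (h.resolve_right fun h => hp h.2).2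
        have hr' := (h'.resolve_right fun h => hq h.2).2
        obtain ⟨_, h1⟩ := hρψ _ hr
        obtain ⟨_, h2⟩ := hρψ _ hr'
        rw [← h1, ← h2]
        congr 2

/-- A path in a graph whose edges are represented by distinct edges of `H` is a Berge path. -/
theorem hasBergePath_of_isPathIn {H : Hypergraph α} {V : Finset α} (hV : (V : Set α) = H.vertexSet)
    {G : SimpleGraph α} {φ : Finset α → Finset α}
    (hφ : ∀ x y, G.Adj x y → (φ {x, y} : Set α) ∈ H.edgeSet ∧ {x, y} ⊆ φ {x, y})
    (hinj : ∀ x y z w, G.Adj x y → G.Adj z w → φ {x, y} = φ {z, w} →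
      ({x, y} : Finset α) = {z, w})
    {l : List α} (hl : IsPathIn G V l) {k : ℕ} (hk : k < l.length) : H.HasBergePath k := by
  have hadj : ∀ i (hi : i < k), G.Adj l[i] l[i + 1] := fun i hi =>
    List.isChain_iff_getElem.1 hl.2.2 i (by omega)
  have hinj' : ∀ i j (hi : i < l.length) (hj : j < l.length), l[i] = l[j] → i = j :=
    fun i j hi hj h => (hl.1.getElem_inj_iff).1 h
  refine ⟨fun i => l[i.1], fun i => (φ {l[i.1], l[i.1 + 1]} : Set α), ?_, ?_, ?_, ?_, ?_⟩
  · intro i j hij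
    exact Fin.ext (hinj' _ _ _ _ hij)
  · intro i j hij
    have h := hinj _ _ _ _ (hadj i i.2) (hadj j j.2) (coe_injective hij)
    have h1 : l[i.1] = l[j.1] ∨ l[i.1] = l[j.1 + 1] := by
      have : l[i.1] ∈ ({l[j.1], l[j.1 + 1]} : Finset α) := by rw [← h]; simp
      simpa using this
    have h2 : l[i.1 + 1] = l[j.1] ∨ l[i.1 + 1] = l[j.1 + 1] := by
      have : l[i.1 + 1] ∈ ({l[j.1], l[j.1 + 1]} : Finset α) := by rw [← h]; simp
      simpa using this
    apply Fin.ext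
    rcases h1 with h1 | h1
    · exact hinj' _ _ _ _ h1
    · have := hinj' _ _ _ _ h1
      rcases h2 with h2 | h2 <;> have := hinj' _ _ _ _ h2 <;> omega
  · intro i
    rw [← hV]
    exact hl.2.1 _ (List.getElem_mem _)
  · exact fun i => (hφ _ _ (hadj i i.2)).1
  · intro i
    have := (hφ _ _ (hadj i i.2)).2
    rw [← coe_subset, coe_pair] at this
    exact this

end BergePath

/-! ### The extremal theorem -/

open BergePath Finset in
theorem corollary6 {α : Type*} (H : Hypergraph α) (n k r : ℕ)
    (hr : 3 ≤ r) (hk : r + 3 ≤ k) (hn : k ≤ n)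
    (hV : H.vertexSet.encard = n) (hH : H.IsUniform r) (hP : ¬ H.HasBergePath k) :
    (H.edgeSet.ncard : ℝ) ≤ (n : ℝ) / (k : ℝ) * (k.choose r : ℝ) ∧
      ((H.edgeSet.ncard : ℝ) = (n : ℝ) / (k : ℝ) * (k.choose r : ℝ) →
        ∀ C : Hypergraph α, H.IsComponent C → C.IsCompleteUniform k r) := by
  classical
  have hfin : H.vertexSet.Finite := Set.finite_of_encard_eq_coe hV
  obtain ⟨V, hVH⟩ := hfin.exists_finset_coe
  have hVn : #V = n := by
    rw [← hVH, Set.encard_coe_eq_coe_finsetCard] at hV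
    exact_mod_cast hV
  have hEfin : H.edgeSet.Finite := hfin.finite_subsets.subset fun e he =>
    H.subset_vertexSet_of_mem_edgeSet' he
  let E : Finset (Finset α) := {e ∈ V.powerset | (e : Set α) ∈ H.edgeSet}
  have hmemE : ∀ e : Finset α, e ∈ E ↔ (e : Set α) ∈ H.edgeSet := fun e => by
    simp only [E, mem_filter, mem_powerset, and_iff_right_iff_imp]
    intro he
    rw [← coe_subset, hVH]
    exact H.subset_vertexSet_of_mem_edgeSet' he
  have hlift : ∀ s ∈ H.edgeSet, ∃ e ∈ E, (e : Set α) = s := fun s hs => by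
    obtain ⟨e, rfl⟩ := (hfin.subset (H.subset_vertexSet_of_mem_edgeSet' hs)).exists_finset_coe
    exact ⟨e, (hmemE e).2 hs, rfl⟩
  have hEcard : #E = H.edgeSet.ncard := by
    have : H.edgeSet = (E.map ⟨_, coe_injective⟩ : Finset (Set α)) := by
      ext s
      simp only [coe_map, Function.Embedding.coeFn_mk, Set.mem_image, mem_coe]
      exact ⟨hlift s, fun ⟨e, he, h⟩ => h ▸ (hmemE e).1 he⟩
    rw [this, Set.ncard_coe_finset, card_map]
  have hE : ∀ e ∈ E, e ⊆ V ∧ #e = r := fun e he => by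
    refine ⟨mem_powerset.1 (mem_filter.1 he).1, ?_⟩
    have := hH _ ((hmemE e).1 he)
    rw [Set.encard_coe_eq_coe_finsetCard] at this
    exact_mod_cast this
  obtain ⟨R, B, hRB, hcard, hBE, hEB, φ, hφ, hinj⟩ := exists_red_blue E hE
  have hpath : ∀ l, IsPathIn (R ⊔ B) V l → l.length ≤ k := fun l hl => by
    by_contra hlen
    exact hP (hasBergePath_of_isPathIn hVH
      (fun x y h => ⟨(hmemE _).1 (hφ x y h).1, (hφ x y h).2⟩) hinj hl (by omega))
  obtain ⟨hle, heq⟩ := graph_bound hRB hr hk V hpath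
  have hform : (n : ℝ) / (k : ℝ) * (k.choose r : ℝ) = #V * ((k.choose r : ℝ) / k) := by
    rw [hVn]; ring
  have hcard' : (#E : ℝ) ≤ #(cliquesIn R 2 V) + #(cliquesIn B r V) := by exact_mod_cast hcard
  rw [hform, ← hEcard]
  refine ⟨hcard'.trans hle, fun hEeq => ?_⟩
  -- Both estimates are tight: no red edges, and the edges of `H` are all the blue `r`-cliques.
  have htight := hle.antisymm (hEeq ▸ hcard')
  obtain ⟨hno, hS⟩ := heq htight
  have hEq : E = cliquesIn B r V := by
    refine eq_of_subset_of_card_le (hEB hno) ?_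
    have hR0 : (0 : ℝ) ≤ #(cliquesIn R 2 V) := by positivity
    have : (#(cliquesIn B r V) : ℝ) ≤ #E := by linarith
    exact_mod_cast this
  rintro C ⟨x, hx, rfl⟩
  obtain ⟨S, hSV, hxS, hSk, hSc, hclosed⟩ := hS x (by rw [← hVH] at hx; exact hx)
  have hvs : (H.component x).vertexSet = S := by
    ext y
    constructor
    · rintro ⟨-, hy⟩
      induction hy with
      | refl => exact hxS
      | @tail y z _ hyz ih =>
        obtain ⟨s, hs, hys, hzs⟩ := hyz
        obtain ⟨e, he, rfl⟩ := hlift s hs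
        by_cases h : y = z
        · exact h ▸ ih
        · rw [hEq, mem_cliquesIn] at he
          exact hclosed y ih z (he.1.1 hzs) (he.2 hys hzs h)
    · intro hy
      refine ⟨by rw [← hVH]; exact hSV hy, ?_⟩
      by_cases h : x = y
      · rw [h]
      · obtain ⟨e, he, hxe, hye⟩ := hBE x y (hSc hxS hy h)
        exact .single ⟨e, (hmemE e).1 he, hxe, hye⟩
  refine ⟨by rw [hvs, Set.encard_coe_eq_coe_finsetCard, hSk], ?_⟩
  ext s
  have hes : s ∈ (H.component x).edgeSet ↔ s ∈ H.edgeSet ∧ s ⊆ S := by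
    rw [← hvs]; rfl
  rw [hes, hvs]
  constructor
  · exact fun h => ⟨h.2, hH s h.1⟩
  · rintro ⟨hsS, hsr⟩
    refine ⟨?_, hsS⟩
    obtain ⟨e, rfl⟩ := (S.finite_toSet.subset hsS).exists_finset_coe
    rw [Set.encard_coe_eq_coe_finsetCard] at hsr
    rw [← hmemE, hEq, mem_cliquesIn]
    exact ⟨⟨(coe_subset.1 hsS).trans hSV, by exact_mod_cast hsr⟩, hSc.subset hsS⟩
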